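/- Let $X$ and $Y$ be (real or complex) Banach spaces, $S\colon X\to Y$ a continuous linear operator and $F\subset X$; let $\mathbb K\in\{\mathbb R,\mathbb C\}$ be the scalar field and $X'$ the continuous dual of $X$. A (deterministic, possibly adaptive) algorithm with $n$ measurements is a map $A_n\colon F\to Y$ of the form $A_n=\phi\circ N_n$ with an arbitrary map $\phi\colon\mathbb K^n\to Y$ and information $N_n$ defined recursively by $N_n(f)=(N_{n-1}(f),L_n(f))$, where the functional $L_n=L_n(\cdot\,;N_{n-1}(f))\in X'$ may depend on the previous measurements $N_{n-1}(f)$. It is non-adaptive if $N_n=(L_1,\dots,L_n)$ with fixed $L_1,\dots,L_n\in X'$. A randomized algorithm is a family $(A_n^\omega)_{\omega\in\Omega}$ of such (possibly adaptive) algorithms indexed by a probability space $(\Omega,\mathcal A,\mathbb P)$ for which $(f,\omega)\mapsto\|S(f)-A_n^\omega(f)\|_Y$ is $\mathcal B_F\otimes\mathcal A$-measurable, where $\mathcal B_F$ is the Borel $\sigma$-algebra of the topology on $F$ induced by the semi-norm with unit ball $F-F$ (its Minkowski functional). Put $$e_n^{\text{det-non}}(S,F)=\inf_{A_n\text{ non-adaptive}}\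 \sup_{f\in F}\|S(f)-A_n(f)\|_Y,\qquad e_n^{\text{ran}}(S,F)=\inf_{(A_n^\omega)\text{ randomized}}\ \sup_{f\in F}\mathbb E\,\|S(f)-A_n^\omega(f)\|_Y,$$ with values in $[0,\infty]$. Then for every convex $F\subset X$, every $n\in\mathbb N=\{1,2,\dots\}$ and every $\alpha>0$, $$e_{2n-1}^{\text{det-non}}(S,F)\;\le\;C_\alpha\,n^{-\alpha+3/2}\,\sup_{0\le k<n}\Big((k+1)^\alpha\,e_k^{\text{ran}}(S,F)\Big)\qquad\text{with } C_\alpha\le 12^{\alpha+1}.$$ With the same bound on $C_\alpha$, the following improvements hold: (a) if $F$ is symmetric ($F=-F$), the exponent $3/2$ can be replaced with $1$; (b) if $Y$ is a Hilbert space, $3/2$ can be replaced with $1$; (c) if $F$ is symmetric and $Y$ is a Hilbert space, $3/2$ can be replaced with $1/2$; (d) if $X$ is a Hilbert space and $F$ its closed unit ball, $3/2$ can be replaced with $1/2$ if the index $2n-1$ on the left is also replaced with $4n-1$. -/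

import Mathlib

open scoped ENNReal Pointwise

universe w u v z

noncomputable section

namespace LinInfo

/-- The norm of `E` is induced by an inner product.  Together with `CompleteSpace E` this says that
the normed space `E` is a Hilbert space. -/
def IsInnerProductNorm (𝕜 E : Type*) [RCLike 𝕜] [NormedAddCommGroup E] [inst : NormedSpace 𝕜 E] :
    Prop :=
  ∃ ip : InnerProductSpace 𝕜 E, ip.toNormedSpace = inst

/-- The topology on `F` given by the distance `(f, g) ↦ gauge (F - F) (g - f)`, i.e. induced by
the semi-norm whose unit ball is `F - F` (the semi-norm lives on the span of `F - F`,
and differences of elements of `F` belong to `F - F`). -/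
abbrev diffTopology {X : Type*} [AddCommGroup X] [Module ℝ X] (F : Set X) : TopologicalSpace F where
  IsOpen U := ∀ f ∈ U, ∃ ε : ℝ, 0 < ε ∧ ∀ g : F, gauge (F - F) ((g : X) - (f : X)) < ε → g ∈ U
  isOpen_univ := fun _ _ => ⟨1, one_pos, fun _ _ => Set.mem_univ _⟩
  isOpen_inter := by
    intro U V hU hV f hf
    obtain ⟨ε, hε, h⟩ := hU f hf.1
    obtain ⟨δ, hδ, h'⟩ := hV f hf.2
    exact ⟨min ε δ, lt_min hε hδ, fun g hg =>
      ⟨h g (hg.trans_le (min_le_left _ _)), h' g (hg.trans_le (min_le_right _ _))⟩⟩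
  isOpen_sUnion := by
    intro 𝒰 h𝒰 f hf
    obtain ⟨U, hU, hfU⟩ := hf
    obtain ⟨ε, hε, h⟩ := h𝒰 U hU f hfU
    exact ⟨ε, hε, fun g hg => ⟨U, hU, h g hg⟩⟩

/-- The Borel σ-algebra of `diffTopology F`. -/
abbrev diffBorel {X : Type*} [AddCommGroup X] [Module ℝ X] (F : Set X) : MeasurableSpace F :=
  @borel F (diffTopology F)

section Algorithms

variable {𝕜 : Type z} {X : Type u} {Y : Type v} [RCLike 𝕜] [NormedAddCommGroup X] [NormedSpace 𝕜 X]
  [NormedAddCommGroup Y] [NormedSpace 𝕜 Y]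

/-- Adaptive information: the functional number `k` is chosen by `L k` from the preceding
`k` measurements (numbered from `0`), and
`adaptiveInfo L f (k + 1) = (adaptiveInfo L f k, L k (adaptiveInfo L f k) f)`. -/
def adaptiveInfo (L : ∀ k : ℕ, (Fin k → 𝕜) → (X →L[𝕜] 𝕜)) (f : X) : ∀ n : ℕ, Fin n → 𝕜
  | 0 => Fin.elim0
  | k + 1 => Fin.snoc (α := fun _ => 𝕜) (adaptiveInfo L f k) (L k (adaptiveInfo L f k) f)

variable (𝕜) in
/-- Deterministic, possibly adaptive algorithms `F → Y` using at most `n` measurements. -/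
def adaptiveAlgorithms (F : Set X) (Y : Type*) (n : ℕ) : Set (F → Y) :=
  {A | ∃ (L : ∀ k : ℕ, (Fin k → 𝕜) → (X →L[𝕜] 𝕜)) (φ : (Fin n → 𝕜) → Y),
    ∀ f : F, A f = φ (adaptiveInfo L (f : X) n)}

variable (𝕜) in
/-- Deterministic non-adaptive algorithms `F → Y`: the same `n` functionals for every input. -/
def nonadaptiveAlgorithms (F : Set X) (Y : Type*) (n : ℕ) : Set (F → Y) :=
  {A | ∃ (L : Fin n → (X →L[𝕜] 𝕜)) (φ : (Fin n → 𝕜) → Y),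
    ∀ f : F, A f = φ (fun i => L i (f : X))}

/-- Randomized, possibly adaptive algorithms for `S` on `F`: families of deterministic algorithms
indexed by a probability space, with jointly measurable error. -/
structure RandomizedAlgorithm [NormedSpace ℝ X] (S : X →L[𝕜] Y) (F : Set X) (n : ℕ) where
  Ω : Type w
  mΩ : MeasurableSpace Ω
  P : MeasureTheory.Measure Ω
  isProb : MeasureTheory.IsProbabilityMeasure P
  alg : Ω → F → Y
  alg_mem : ∀ ω, alg ω ∈ adaptiveAlgorithms 𝕜 F Y n
  measurable_error :
    @Measurable (F × Ω) ℝ ((diffBorel F).prod mΩ) _ (fun p : F × Ω => ‖S (p.1 : X) - alg p.2 p.1‖)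

/-- Worst-case error `sup_{f ∈ F} 𝔼 ‖S f - A f‖` of a randomized algorithm, in `[0, ∞]`. -/
def RandomizedAlgorithm.error [NormedSpace ℝ X] {S : X →L[𝕜] Y} {F : Set X} {n : ℕ}
    (A : RandomizedAlgorithm.{w, u, v, z} S F n) : ℝ≥0∞ :=
  letI := A.mΩ
  ⨆ f : F, ∫⁻ ω, ‖S (f : X) - A.alg ω f‖ₑ ∂A.P

/-- `n`-th minimal worst-case error of deterministic non-adaptive algorithms, in `[0, ∞]`. -/
def eDetNon (S : X →L[𝕜] Y) (F : Set X) (n : ℕ) : ℝ≥0∞ :=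
  ⨅ A ∈ nonadaptiveAlgorithms 𝕜 F Y n, ⨆ f : F, ‖S (f : X) - A f‖ₑ

/-- `n`-th minimal worst-case error of randomized (adaptive) algorithms, in `[0, ∞]`. -/
def eRan [NormedSpace ℝ X] (S : X →L[𝕜] Y) (F : Set X) (n : ℕ) : ℝ≥0∞ :=
  ⨅ A : RandomizedAlgorithm.{w, u, v, z} S F n, A.error

end Algorithms

end LinInfo

end

/-! Suppose `eDetNon` exceeds `2ρ`. Then no admissible number of functionals separates all pairs `f,
g ∈ F` with `‖S (f - g)‖ > 2ρ`. Greedy selection yields half differences `h i` and functionals `y i`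
of norm at most one for which the real `2n × 2n` matrix `re (y i (S (h j)))` is triangular with
diagonal at least `ρ`. Its determinant is at least `ρ ^ (2n)`, and the absolute value of the
determinant is the product of the singular values, so it suffices to bound each of these by a
randomized error (`le_of_triangular`).

The first `j + 1` singular directions give a Euclidean ball inside `F` on which `S` is bounded below
by a multiple of the singular value of index `j`. On such a ball of dimension `D > 4k`, randomized
adaptive algorithms with `k` measurements err by at least half the lower bound (`ofReal_le_eRan`).
This is an averaging argument over a radial distribution: a measurement costs at most two real
dimensions, and the distribution on each slice is radial again (`lintegral_error_ge`).

The power of `n` is the ratio `b / a`, where `a` scales the ball to fit into `F` and `b` bounds the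
map `z ↦ (re (y i z))`. In general `a = 1/(2n)` and `b = √(2n)`. Symmetry improves `a` to `1/√(2n)`,
orthonormal `h i` in the unit ball improve it to `1`, and orthonormal directions in `Y` improve `b`
to `1`. -/

namespace LinInfo

/-! ### Average error of adaptive information under radial weights -/

open MeasureTheory Module

/-- Integration over a Euclidean space by slicing parallel to a subspace. -/
theorem exists_slicing {D : ℕ} (K : Submodule ℝ (EuclideanSpace ℝ (Fin D))) :
    ∃ (d : ℕ) (p : EuclideanSpace ℝ (Fin d) →ₗᵢ[ℝ] EuclideanSpace ℝ (Fin D))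
      (q : EuclideanSpace ℝ (Fin (finrank ℝ K)) →ₗᵢ[ℝ] EuclideanSpace ℝ (Fin D)),
      (∀ z, q z ∈ K) ∧ (∀ t z, inner ℝ (p t) (q z) = 0) ∧
      ∀ f : EuclideanSpace ℝ (Fin D) → ℝ≥0∞, Measurable f →
        ∫⁻ x, f x = ∫⁻ t, ∫⁻ z, f (p t + q z) := by
  set q : EuclideanSpace ℝ (Fin (finrank ℝ K)) →ₗᵢ[ℝ] EuclideanSpace ℝ (Fin D) :=
    K.subtypeₗᵢ.comp (stdOrthonormalBasis ℝ K).repr.symm.toLinearIsometry with hq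
  set p : EuclideanSpace ℝ (Fin (finrank ℝ Kᗮ)) →ₗᵢ[ℝ] EuclideanSpace ℝ (Fin D) :=
    Kᗮ.subtypeₗᵢ.comp (stdOrthonormalBasis ℝ Kᗮ).repr.symm.toLinearIsometry with hp
  have hqK : ∀ z, q z ∈ K := fun z => by simp [hq]
  have hpK : ∀ t, p t ∈ Kᗮ := fun t => Submodule.coe_mem _
  have horth : ∀ t z, inner ℝ (p t) (q z) = 0 := fun t z =>
    (Submodule.mem_orthogonal' K (p t)).1 (hpK t) _ (hqK z)
  refine ⟨_, p, q, hqK, horth, fun f hf => ?_⟩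
  let Φ : WithLp 2 (EuclideanSpace ℝ (Fin (finrank ℝ Kᗮ)) × EuclideanSpace ℝ (Fin (finrank ℝ K)))
      →ₗᵢ[ℝ] EuclideanSpace ℝ (Fin D) :=
    { toLinearMap := (p.toLinearMap.coprod q.toLinearMap) ∘ₗ
        (WithLp.linearEquiv 2 ℝ _).toLinearMap
      norm_map' := fun x => by
        have h1 : ‖p x.fst + q x.snd‖ ^ 2 = ‖x‖ ^ 2 := by
          rw [norm_add_sq_real, horth, WithLp.prod_norm_sq_eq_of_L2, p.norm_map, q.norm_map]
          ring
        have h2 := (pow_left_inj₀ (norm_nonneg _) (norm_nonneg _) two_ne_zero).1 h1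
        simpa using h2 }
  have hfr : finrank ℝ (WithLp 2 (EuclideanSpace ℝ (Fin (finrank ℝ Kᗮ)) ×
      EuclideanSpace ℝ (Fin (finrank ℝ K)))) = finrank ℝ (EuclideanSpace ℝ (Fin D)) := by
    rw [(WithLp.linearEquiv 2 ℝ _).finrank_eq, finrank_prod, finrank_euclideanSpace_fin,
      finrank_euclideanSpace_fin, add_comm, K.finrank_add_finrank_orthogonal]
  have hmp := ((Φ.toLinearIsometryEquiv hfr).measurePreserving.comp
    (WithLp.volume_preserving_toLp _ _)).lintegral_comp hf
  rw [← hmp, Measure.volume_eq_prod]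
  rw [lintegral_prod]
  · rfl
  · refine (hf.comp ?_).aemeasurable
    exact ((Φ.toLinearIsometryEquiv hfr).measurePreserving.comp
      (WithLp.volume_preserving_toLp _ _)).measurable

/-- All directional second moments of a radial weight coincide. -/
theorem lintegral_inner_sq_eq {D : ℕ} (W : ℝ → ℝ≥0∞) (hW : Measurable W)
    {x y : EuclideanSpace ℝ (Fin D)} (hxy : ‖x‖ = ‖y‖) :
    ∫⁻ v, ENNReal.ofReal (inner ℝ x v ^ 2) * W (‖v‖ ^ 2) =
      ∫⁻ v, ENNReal.ofReal (inner ℝ y v ^ 2) * W (‖v‖ ^ 2) := by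
  -- The reflection in the hyperplane orthogonal to `x - y` exchanges `x` and `y` and preserves both
  -- volume and norm.
  have hm := (Submodule.reflection (ℝ ∙ (x - y))ᗮ).measurePreserving.lintegral_comp
    (f := fun v => ENNReal.ofReal (inner ℝ y v ^ 2) * W (‖v‖ ^ 2)) (by fun_prop)
  rw [← hm]
  refine lintegral_congr fun v => ?_
  rw [LinearIsometryEquiv.norm_map]
  congr 3
  have h := LinearIsometryEquiv.inner_map_map (Submodule.reflection (ℝ ∙ (x - y))ᗮ) x v
  rwa [Submodule.reflection_sub hxy, eq_comm] at h

theorem lintegral_norm_sq_eq {D : ℕ} (W : ℝ → ℝ≥0∞) (hW : Measurable W)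
    {x : EuclideanSpace ℝ (Fin D)} (hx : ‖x‖ = 1) :
    ∫⁻ v : EuclideanSpace ℝ (Fin D), ENNReal.ofReal (‖v‖ ^ 2) * W (‖v‖ ^ 2) =
      D * ∫⁻ v, ENNReal.ofReal (inner ℝ x v ^ 2) * W (‖v‖ ^ 2) := by
  let b := EuclideanSpace.basisFun (Fin D) ℝ
  have h1 : ∀ v : EuclideanSpace ℝ (Fin D), ENNReal.ofReal (‖v‖ ^ 2) * W (‖v‖ ^ 2) =
      ∑ i, ENNReal.ofReal (inner ℝ (b i) v ^ 2) * W (‖v‖ ^ 2) := fun v => by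
    rw [← Finset.sum_mul, ← ENNReal.ofReal_sum_of_nonneg fun i _ => sq_nonneg _]
    rw [← b.sum_sq_norm_inner_right v]
    simp
  simp_rw [h1]
  rw [lintegral_finsetSum _ fun i _ => by fun_prop]
  rw [Finset.sum_congr rfl fun i _ => lintegral_inner_sq_eq W hW
    (show ‖b i‖ = ‖x‖ by rw [hx, b.norm_eq_one])]
  simp

variable {𝕜 : Type z} {X : Type u} [RCLike 𝕜] [NormedAddCommGroup X] [NormedSpace 𝕜 X]

theorem adaptiveInfo_succ_congr (L : ∀ k : ℕ, (Fin k → 𝕜) → (X →L[𝕜] 𝕜)) {f g : X} {k : ℕ}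
    (h : adaptiveInfo L f k = adaptiveInfo L g k)
    (h' : L k (adaptiveInfo L g k) f = L k (adaptiveInfo L g k) g) :
    adaptiveInfo L f (k + 1) = adaptiveInfo L g (k + 1) := by
  simp only [adaptiveInfo, h, h']

theorem finrank_le_finrank_ker_add_two {D : ℕ} (l : EuclideanSpace ℝ (Fin D) →ₗ[ℝ] 𝕜) :
    ∃ K : Submodule ℝ (EuclideanSpace ℝ (Fin D)), (∀ v ∈ K, l v = 0) ∧ D ≤ finrank ℝ K + 2 := by
  let m : EuclideanSpace ℝ (Fin D) →ₗ[ℝ] ℝ × ℝ :=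
    (RCLike.reLm.comp l).prod (RCLike.imLm.comp l)
  refine ⟨LinearMap.ker m, fun v hv => ?_, ?_⟩
  · have : RCLike.re (l v) = 0 ∧ RCLike.im (l v) = 0 := by simpa [m] using hv
    exact RCLike.ext (by simp [this]) (by simp [this])
  · have h1 := m.finrank_range_add_finrank_ker
    have h2 := Submodule.finrank_le (LinearMap.range m)
    rw [finrank_euclideanSpace_fin] at h1
    rw [finrank_prod, finrank_self] at h2
    omega

/-- Average-case lower bound for adaptive information and a radial weight. -/
theorem lintegral_error_ge [NormedSpace ℝ X] [IsScalarTower ℝ 𝕜 X]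
    (L : ∀ k : ℕ, (Fin k → 𝕜) → (X →L[𝕜] 𝕜)) (k : ℕ) (σ : ℝ) (hσ : 0 ≤ σ) (j : ℕ) :
    ∀ (m : ℕ) (_ : m + j = k) (D : ℕ) (a : X) (A : EuclideanSpace ℝ (Fin D) →ₗ[ℝ] X)
      (_ : ∀ v, adaptiveInfo L (a + A v) m = adaptiveInfo L a m)
      (W : ℝ → ℝ≥0∞) (_ : Measurable W) (_ : ∀ s, W s ≠ 0 → s ≤ 1)
      (g : EuclideanSpace ℝ (Fin D) → ℝ≥0∞) (_ : Measurable g)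
      (_ : ∀ v v', W (‖v‖ ^ 2) ≠ 0 → W (‖v'‖ ^ 2) ≠ 0 →
        adaptiveInfo L (a + A v) k = adaptiveInfo L (a + A v') k →
        ENNReal.ofReal (σ * ‖v - v'‖) ≤ g v + g v')
      (x : EuclideanSpace ℝ (Fin D)) (_ : ‖x‖ = 1),
      ENNReal.ofReal σ * (((D - 2 * j : ℕ) : ℝ≥0∞) *
        ∫⁻ v, ENNReal.ofReal (inner ℝ x v ^ 2) * W (‖v‖ ^ 2)) ≤ ∫⁻ v, g v * W (‖v‖ ^ 2) := by
  -- `j` counts the measurements still to be made after the first `m`. Base point, map and weight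
  -- stay general because each slice brings its own.
  induction j with
  | zero =>
    intro m hm D a A hN W hW hW1 g hg hgg x hx
    obtain rfl : m = k := by omega
    rw [mul_zero, Nat.sub_zero, ← lintegral_norm_sq_eq W hW hx]
    have hneg := ((LinearIsometryEquiv.neg ℝ :
      EuclideanSpace ℝ (Fin D) ≃ₗᵢ[ℝ] _)).measurePreserving.lintegral_comp
      (f := fun v => g v * W (‖v‖ ^ 2)) (by fun_prop)
    -- All points now yield the same information, so `v` and `-v` can be paired: `2σ‖v‖ ≤ g v + g
    -- (-v)`. On the support of the weight `‖v‖ ≥ ‖v‖ ^ 2`.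
    have h2 : 2 * (ENNReal.ofReal σ * ∫⁻ v : EuclideanSpace ℝ (Fin D),
        ENNReal.ofReal (‖v‖ ^ 2) * W (‖v‖ ^ 2)) ≤ 2 * ∫⁻ v, g v * W (‖v‖ ^ 2) := by
      rw [← lintegral_const_mul _ (by fun_prop), ← lintegral_const_mul _ (by fun_prop)]
      calc _ ≤ ∫⁻ v, g v * W (‖v‖ ^ 2) + g (-v) * W (‖v‖ ^ 2) := by
            refine lintegral_mono fun v => ?_
            by_cases h0 : W (‖v‖ ^ 2) = 0
            · simp [h0]
            · have h1 := hgg v (-v) h0 (by rwa [norm_neg]) (by rw [hN, hN])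
              rw [← add_mul, ← mul_assoc, ← mul_assoc]
              refine mul_le_mul_left ?_ _
              refine le_trans ?_ h1
              have hv1 : ‖v‖ ≤ 1 := by
                have := hW1 _ h0
                nlinarith [norm_nonneg v]
              have h2 : (2 : ℝ≥0∞) * ENNReal.ofReal σ * ENNReal.ofReal (‖v‖ ^ 2) =
                  ENNReal.ofReal (2 * σ * ‖v‖ ^ 2) := by
                rw [ENNReal.ofReal_mul (by positivity), ENNReal.ofReal_mul zero_le_two,
                  ENNReal.ofReal_ofNat]
              rw [h2]
              refine ENNReal.ofReal_le_ofReal ?_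
              rw [sub_neg_eq_add, ← two_smul ℝ v, norm_smul, Real.norm_two]
              have : ‖v‖ ^ 2 ≤ ‖v‖ := by nlinarith [norm_nonneg v]
              nlinarith
        _ = _ := by
            rw [lintegral_add_left (by fun_prop), two_mul]
            congr 1
            rw [← hneg]
            simp
    exact (ENNReal.mul_le_mul_iff_right (by simp) (by simp)).1 h2
  | succ j ih =>
    intro m hm D a A hN W hW hW1 g hg hgg x hx
    -- On a slice parallel to `K` the next measurement is constant, so the induction hypothesis
    -- applies there.
    obtain ⟨K, hK, hKD⟩ := finrank_le_finrank_ker_add_two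
      ((L m (adaptiveInfo L a m)).toLinearMap.restrictScalars ℝ ∘ₗ A)
    obtain ⟨d, p, q, hq, horth, hint⟩ := exists_slicing K
    rcases Nat.eq_zero_or_pos (finrank ℝ K) with h0 | hpos
    -- If `K` is trivial then `D ≤ 2`, and truncated subtraction makes the left side zero.
    · simp [show D - 2 * (j + 1) = 0 by omega]
    obtain ⟨y, hy⟩ : ∃ y : EuclideanSpace ℝ (Fin (finrank ℝ K)), ‖y‖ = 1 :=
      ⟨EuclideanSpace.single ⟨0, hpos⟩ 1, by simp⟩
    have hnorm : ∀ t z, ‖p t + q z‖ ^ 2 = ‖t‖ ^ 2 + ‖z‖ ^ 2 := fun t z => by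
      rw [norm_add_sq_real, horth, p.norm_map, q.norm_map]
      ring
    -- The second moment in a single direction survives slicing: by radiality the direction can be
    -- moved into `K`, where its inner product ignores `p t`.
    rw [lintegral_inner_sq_eq W hW (y := q y) (by rw [hx, q.norm_map, hy]),
      hint _ (by fun_prop), hint (fun v => g v * _) (by fun_prop)]
    rw [← lintegral_const_mul', ← lintegral_const_mul' _ _ ENNReal.ofReal_ne_top]
    rotate_left
    · simp
    refine lintegral_mono fun t => ?_
    simp only [hnorm, inner_add_right, real_inner_comm (p t) (q y), horth, zero_add,
      LinearIsometry.inner_map_map]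
    have hstep := ih (m + 1) (by omega) (finrank ℝ K) (a + A (p t)) (A ∘ₗ q.toLinearMap)
      (fun v => by
        have e1 : a + A (p t) + (A ∘ₗ q.toLinearMap) v = a + A (p t + q v) := by
          simp [add_assoc]
        rw [e1]
        refine adaptiveInfo_succ_congr L (by rw [hN, hN]) ?_
        rw [hN]
        have := hK _ (hq v)
        simp only [LinearMap.comp_apply] at this
        simp only [map_add]
        rw [show (L m (adaptiveInfo L a m)) (A (q v)) = 0 from this, add_zero])
      (fun s => W (‖t‖ ^ 2 + s)) (by fun_prop)
      (fun s hs => by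
        have := hW1 _ hs
        nlinarith [sq_nonneg ‖t‖])
      (fun z => g (p t + q z)) (by fun_prop)
      (fun v v' hv hv' hvv => by
        have := hgg (p t + q v) (p t + q v') (by rwa [hnorm]) (by rwa [hnorm])
          (by simpa [add_assoc] using hvv)
        rwa [add_sub_add_left_eq_sub, ← map_sub, q.norm_map] at this) y hy
    refine le_trans ?_ hstep
    exact mul_le_mul_right (mul_le_mul_left (Nat.cast_le.2 (by omega)) _) _

end LinInfo

/-! ### Singular directions -/

namespace LinInfo

open MeasureTheory Module

/-- The first `j + 1` singular directions of an operator. -/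
theorem exists_isometry_singularValues {D : ℕ}
    (T : EuclideanSpace ℝ (Fin D) →ₗ[ℝ] EuclideanSpace ℝ (Fin D)) (j : ℕ) (hj : j < D) :
    ∃ q : EuclideanSpace ℝ (Fin (j + 1)) →ₗᵢ[ℝ] EuclideanSpace ℝ (Fin D),
      ∀ v, T.singularValues j * ‖v‖ ≤ ‖T (q v)‖ := by
  have hn : finrank ℝ (EuclideanSpace ℝ (Fin D)) = D := finrank_euclideanSpace_fin
  -- The directions are eigenvectors of `T* T`, ordered so that the first `j + 1` have singular
  -- values at least the one of index `j`.
  set hT := T.isSymmetric_adjoint_comp_self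
  set b := hT.eigenvectorBasis hn with hb
  let e : Fin (j + 1) → Fin D := Fin.castLE hj
  have he : Function.Injective e := Fin.castLE_injective hj
  have hon : Orthonormal ℝ (b ∘ e) := b.orthonormal.comp _ he
  let ql : EuclideanSpace ℝ (Fin (j + 1)) →ₗ[ℝ] EuclideanSpace ℝ (Fin D) :=
    (Fintype.linearCombination ℝ (b ∘ e)) ∘ₗ (WithLp.linearEquiv 2 ℝ _).toLinearMap
  have hql : ∀ v, ql v = ∑ i, v i • b (e i) := fun v => by
    simp [ql, Fintype.linearCombination_apply]
  have hnorm : ∀ v, ‖ql v‖ ^ 2 = ∑ i, v i ^ 2 := fun v => by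
    rw [← real_inner_self_eq_norm_sq, hql]
    refine (hon.inner_sum _ _ _).trans ?_
    simp [sq]
  have hTnorm : ∀ v, ‖T (ql v)‖ ^ 2 = ∑ i : Fin (j + 1), T.singularValues (i : ℕ) ^ 2 * v i ^ 2 := fun v => by
    rw [← real_inner_self_eq_norm_sq, ← LinearMap.adjoint_inner_left]
    have h1 : (LinearMap.adjoint T) (T (ql v)) =
        ∑ i : Fin (j + 1), (T.singularValues (i : ℕ) ^ 2 * v i) • b (e i) := by
      rw [← LinearMap.comp_apply, hql, map_sum]
      refine Finset.sum_congr rfl fun i _ => ?_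
      rw [map_smul, hb, hT.apply_eigenvectorBasis hn, ← T.sq_singularValues_fin hn, smul_smul,
        mul_comm]
      rfl
    rw [h1, hql]
    refine (hon.inner_sum (fun i : Fin (j + 1) => T.singularValues (i : ℕ) ^ 2 * v i) _ _).trans ?_
    refine Finset.sum_congr rfl fun i _ => ?_
    simp
    ring
  refine ⟨{ toLinearMap := ql, norm_map' := fun v => ?_ }, fun v => ?_⟩
  · rw [← pow_left_inj₀ (norm_nonneg _) (norm_nonneg _) two_ne_zero, hnorm,
      EuclideanSpace.real_norm_sq_eq]
  · change _ ≤ ‖T (ql v)‖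
    refine le_of_sq_le_sq ?_ (norm_nonneg _)
    rw [hTnorm, mul_pow, EuclideanSpace.real_norm_sq_eq, Finset.mul_sum]
    refine Finset.sum_le_sum fun i _ => mul_le_mul_of_nonneg_right ?_ (sq_nonneg _)
    exact pow_le_pow_left₀ (T.singularValues_nonneg _)
      (T.singularValues_antitone (Nat.lt_succ_iff.1 i.2)) 2

end LinInfo

/-! ### Lower bound for randomized algorithms -/

namespace LinInfo

open MeasureTheory Module

/-- The indicator function of the shell `q ≤ ‖v‖ ^ 2 ≤ 1`, as a function of `‖v‖ ^ 2`. -/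
noncomputable def shellWeight (q : ℝ) : ℝ → ℝ≥0∞ := Set.indicator (Set.Icc q 1) 1

theorem measurable_shellWeight (q : ℝ) : Measurable (shellWeight q) :=
  measurable_one.indicator measurableSet_Icc

theorem mem_Icc_of_shellWeight_ne_zero {q s : ℝ} (h : shellWeight q s ≠ 0) : s ∈ Set.Icc q 1 :=
  Set.mem_of_indicator_ne_zero h

/-- Errors are jointly measurable only for the Borel structure of the gauge topology, so a
parametrization of points of `F` has to be continuous for that topology. -/
theorem measurable_diffBorel_of_gauge_le {X : Type*} [AddCommGroup X] [Module ℝ X] {F : Set X}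
    {E : Type*} [NormedAddCommGroup E] [MeasurableSpace E] [BorelSpace E] (T : E → F) (r : E → E)
    (hr : Continuous r) (hT : ∀ v v', gauge (F - F) ((T v' : X) - T v) ≤ ‖r v' - r v‖) :
    @Measurable E F _ (diffBorel F) T := by
  let := diffTopology F
  let := diffBorel F
  have : BorelSpace F := ⟨rfl⟩
  refine Continuous.measurable (continuous_def.2 fun U hU => ?_)
  refine isOpen_iff_mem_nhds.2 fun v hv => ?_
  obtain ⟨ε, hε, h⟩ := hU (T v) hv
  have h1 : ∀ᶠ v' in nhds v, ‖r v' - r v‖ < ε := by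
    have := Metric.continuous_iff'.1 hr v ε hε
    simpa [dist_eq_norm] using this
  filter_upwards [h1] with v' hv'
  exact h _ ((hT v v').trans_lt hv')

theorem lintegral_shellWeight_pos {D : ℕ} (hD : 0 < D) {q : ℝ} (hq : 0 ≤ q) (hq1 : q < 1) :
    0 < ∫⁻ v : EuclideanSpace ℝ (Fin D), shellWeight q (‖v‖ ^ 2) := by
  have hopen : IsOpen {v : EuclideanSpace ℝ (Fin D) | q < ‖v‖ ^ 2 ∧ ‖v‖ ^ 2 < 1} :=
    IsOpen.and (isOpen_lt (by fun_prop) (by fun_prop)) (isOpen_lt (by fun_prop) (by fun_prop))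
  have hpos := hopen.measure_pos volume
    ⟨EuclideanSpace.single ⟨0, hD⟩ (Real.sqrt ((q + 1) / 2)), by
      simp only [Set.mem_ofPred_eq, PiLp.norm_single, Real.norm_eq_abs, sq_abs]
      rw [Real.sq_sqrt (by positivity)]
      constructor <;> linarith⟩
  refine hpos.trans_le ?_
  rw [← lintegral_indicator_one hopen.measurableSet]
  refine lintegral_mono fun v => Set.indicator_apply_le' (fun hv => ?_) fun _ => zero_le
  rw [shellWeight, Set.indicator_of_mem]
  · rfl
  · exact ⟨hv.1.le, hv.2.le⟩

theorem lintegral_shellWeight_lt_top {D : ℕ} (q : ℝ) :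
    ∫⁻ v : EuclideanSpace ℝ (Fin D), shellWeight q (‖v‖ ^ 2) < ∞ := by
  refine lt_of_le_of_lt ?_
    (measure_closedBall_lt_top (μ := volume) (x := (0 : EuclideanSpace ℝ (Fin D))) (r := 1))
  rw [← lintegral_indicator_one measurableSet_closedBall]
  refine lintegral_mono fun v => ?_
  by_cases h0 : shellWeight q (‖v‖ ^ 2) = 0
  · simp [h0]
  · have := mem_Icc_of_shellWeight_ne_zero h0
    rw [Set.indicator_of_mem]
    · exact Set.indicator_le_self _ _ _
    · rw [mem_closedBall_zero_iff]
      nlinarith [norm_nonneg v, this.2]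

/-- Averaging the bounds over `ω` and exchanging integrals gives `σ (D - 2k) M ≤ e V`, while `‖v‖ ^
2 ≥ q` on the shell gives `D M ≥ q V`. The value of `q` makes `q (D - 2k) / D` equal to `1/2`; `4k <
D` keeps `q < 1`, so that the shell has positive mass. -/
theorem ofReal_half_le_of_shellWeight {k D : ℕ} (hD : 4 * k < D) {σ : ℝ} (hσ : 0 ≤ σ) (q : ℝ)
    (hq : q = D / (2 * (D - 2 * k))) {Ω : Type*} [MeasurableSpace Ω] (P : Measure Ω)
    [IsProbabilityMeasure P] (G : Ω → EuclideanSpace ℝ (Fin D) → ℝ≥0∞)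
    (hG : Measurable fun p : EuclideanSpace ℝ (Fin D) × Ω => G p.2 p.1) (e : ℝ≥0∞)
    (he : ∀ v, ∫⁻ ω, G ω v ∂P ≤ e) (x : EuclideanSpace ℝ (Fin D)) (hx : ‖x‖ = 1)
    (hlow : ∀ ω, ENNReal.ofReal σ * (((D - 2 * k : ℕ) : ℝ≥0∞) *
      ∫⁻ v, ENNReal.ofReal (inner ℝ x v ^ 2) * shellWeight q (‖v‖ ^ 2)) ≤
        ∫⁻ v, G ω v * shellWeight q (‖v‖ ^ 2)) :
    ENNReal.ofReal (σ / 2) ≤ e := by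
  have hD0 : 0 < D := by omega
  have hDr : (4 * k : ℝ) < D := by exact_mod_cast hD
  have hk0 : (0 : ℝ) ≤ k := k.cast_nonneg
  have hden : (0 : ℝ) < 2 * (D - 2 * k) := by linarith
  have hq0 : 0 ≤ q := by rw [hq]; positivity
  have hq1 : q < 1 := by rw [hq, div_lt_one hden]; linarith
  have hW := measurable_shellWeight q
  set M : ℝ≥0∞ := ∫⁻ v, ENNReal.ofReal (inner ℝ x v ^ 2) * shellWeight q (‖v‖ ^ 2) with hM
  set V : ℝ≥0∞ := ∫⁻ v : EuclideanSpace ℝ (Fin D), shellWeight q (‖v‖ ^ 2) with hV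
  have hMV : ENNReal.ofReal q * V ≤ D * M := by
    rw [hM, ← lintegral_norm_sq_eq _ hW hx, hV, ← lintegral_const_mul _ (by fun_prop)]
    refine lintegral_mono fun v => ?_
    by_cases h0 : shellWeight q (‖v‖ ^ 2) = 0
    · simp [h0]
    · exact mul_le_mul_left (ENNReal.ofReal_le_ofReal (mem_Icc_of_shellWeight_ne_zero h0).1) _
  have hmain : ENNReal.ofReal σ * (((D - 2 * k : ℕ) : ℝ≥0∞) * M) ≤ e * V := by
    calc _ = ∫⁻ _ : Ω, ENNReal.ofReal σ * (((D - 2 * k : ℕ) : ℝ≥0∞) * M) ∂P := by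
          simp
      _ ≤ ∫⁻ ω, (∫⁻ v, G ω v * shellWeight q (‖v‖ ^ 2)) ∂P := lintegral_mono hlow
      _ = ∫⁻ v, (∫⁻ ω, G ω v * shellWeight q (‖v‖ ^ 2) ∂P) := by
          refine lintegral_lintegral_swap (Measurable.aemeasurable ?_)
          exact (hG.comp measurable_swap).mul (by fun_prop)
      _ ≤ ∫⁻ v : EuclideanSpace ℝ (Fin D), e * shellWeight q (‖v‖ ^ 2) := by
          refine lintegral_mono fun v => ?_
          rw [lintegral_mul_const (f := fun ω => G ω v) _ (hG.comp measurable_prodMk_left)]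
          exact mul_le_mul_left (he v) _
      _ = _ := by rw [lintegral_const_mul _ (by fun_prop)]
  have hfin : ENNReal.ofReal (σ / 2) * (D * V) ≤ e * (D * V) := by
    calc ENNReal.ofReal (σ / 2) * (D * V)
        = ENNReal.ofReal σ * (((D - 2 * k : ℕ) : ℝ≥0∞) * (ENNReal.ofReal q * V)) := by
          have h1 : ((D - 2 * k : ℕ) : ℝ≥0∞) = ENNReal.ofReal (D - 2 * k) := by
            rw [← ENNReal.ofReal_natCast, Nat.cast_sub (by omega)]
            push_cast
            rfl
          rw [h1, ← ENNReal.ofReal_natCast D, ← mul_assoc, ← mul_assoc, ← mul_assoc,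
            ← ENNReal.ofReal_mul (by positivity), ← ENNReal.ofReal_mul hσ,
            ← ENNReal.ofReal_mul (mul_nonneg hσ (by linarith))]
          congr 2
          rw [hq]
          have : (D : ℝ) - 2 * k ≠ 0 := by linarith
          field_simp
      _ ≤ ENNReal.ofReal σ * (((D - 2 * k : ℕ) : ℝ≥0∞) * (D * M)) := by gcongr
      _ = D * (ENNReal.ofReal σ * (((D - 2 * k : ℕ) : ℝ≥0∞) * M)) := by ring
      _ ≤ D * (e * V) := by gcongr
      _ = _ := by ring
  refine (ENNReal.mul_le_mul_iff_left ?_ ?_).1 hfin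
  · exact mul_ne_zero (by exact_mod_cast hD0.ne') (lintegral_shellWeight_pos hD0 hq0 hq1).ne'
  · exact ENNReal.mul_ne_top (ENNReal.natCast_ne_top D) (lintegral_shellWeight_lt_top q).ne

variable {𝕜 : Type z} {X : Type u} {Y : Type v} [RCLike 𝕜] [NormedAddCommGroup X] [NormedSpace 𝕜 X]
  [NormedAddCommGroup Y] [NormedSpace 𝕜 Y] [NormedSpace ℝ X]

theorem RandomizedAlgorithm.measurable_enorm_comp {S : X →L[𝕜] Y} {F : Set X} {k : ℕ}
    (R : RandomizedAlgorithm.{w, u, v, z} S F k) {E : Type*} [MeasurableSpace E] (T : E → F)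
    (hT : @Measurable E F _ (diffBorel F) T) :
    letI := R.mΩ
    Measurable fun p : E × R.Ω => ‖S (T p.1 : X) - R.alg p.2 (T p.1)‖ₑ := by
  let := R.mΩ
  let := diffBorel F
  have h1 : Measurable fun p : E × R.Ω => (T p.1, p.2) :=
    (hT.comp measurable_fst).prodMk measurable_snd
  have h2 := (R.measurable_error.comp h1).ennreal_ofReal
  simpa only [Function.comp_def, ofReal_norm] using h2

/-- Lower bound for randomized algorithms by a Euclidean ball of large dimension in `F`. -/
theorem ofReal_le_eRan [IsScalarTower ℝ 𝕜 X] (S : X →L[𝕜] Y) (F : Set X) {k D : ℕ}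
    (hD : 4 * k < D) {σ : ℝ} (hσ : 0 ≤ σ) (a : X) (A : EuclideanSpace ℝ (Fin D) →ₗ[ℝ] X)
    (hA : ∀ v, ‖v‖ ≤ 1 → a + A v ∈ F) (hS : ∀ v, σ * ‖v‖ ≤ ‖S (A v)‖) :
    ENNReal.ofReal (σ / 2) ≤ eRan.{w, u, v, z} S F k := by
  refine le_iInf fun R => ?_
  let := R.mΩ
  have := R.isProb
  have hD0 : 0 < D := by omega
  -- The radial retraction onto the unit ball keeps `T` inside `F` everywhere and changes nothing on
  -- the support of the weight.
  let r : EuclideanSpace ℝ (Fin D) → EuclideanSpace ℝ (Fin D) := fun v => (max 1 ‖v‖)⁻¹ • v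
  have hmax : ∀ v : EuclideanSpace ℝ (Fin D), 0 < max 1 ‖v‖ := fun v => by positivity
  have hr1 : ∀ v, ‖r v‖ ≤ 1 := fun v => by
    rw [norm_smul, norm_inv, Real.norm_of_nonneg (hmax v).le, inv_mul_le_one₀ (hmax v)]
    exact le_max_right _ _
  have hrc : Continuous r :=
    Continuous.smul (Continuous.inv₀ (by fun_prop) fun v => (hmax v).ne') continuous_id
  have hrv : ∀ v, ‖v‖ ^ 2 ≤ 1 → r v = v := fun v hv => by
    have h1 : ‖v‖ ≤ 1 := by nlinarith [norm_nonneg v]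
    simp [r, max_eq_left h1]
  let T : EuclideanSpace ℝ (Fin D) → F := fun v => ⟨a + A (r v), hA _ (hr1 v)⟩
  have hgauge : ∀ v, gauge (F - F) (A v) ≤ ‖v‖ := fun v => by
    rcases eq_or_ne v 0 with rfl | hv
    · simp
    refine gauge_le_of_mem (norm_nonneg v) ?_
    refine ⟨A (‖v‖⁻¹ • v), ⟨a + A (‖v‖⁻¹ • v), hA _ (by simp [norm_smul, hv]),
      a + A 0, hA _ (by simp), by simp⟩, ?_⟩
    simp [smul_smul, hv]
  have hT : @Measurable _ F _ (diffBorel F) T :=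
    measurable_diffBorel_of_gauge_le T r hrc fun v v' => by
      simpa [T, map_sub] using hgauge (r v' - r v)
  have hTv : ∀ v, ‖v‖ ^ 2 ≤ 1 → (T v : X) = a + A v := fun v hv => by simp [T, hrv v hv]
  have hx : ‖(EuclideanSpace.single ⟨0, hD0⟩ 1 : EuclideanSpace ℝ (Fin D))‖ = 1 := by simp
  have hGm := R.measurable_enorm_comp T hT
  refine ofReal_half_le_of_shellWeight hD hσ _ rfl R.P
    (fun ω v => ‖S (T v : X) - R.alg ω (T v)‖ₑ) hGm R.error
    (fun v => le_iSup (fun f : F => lintegral R.P fun ω => ‖S (f : X) - R.alg ω f‖ₑ) (T v)) _ hx fun ω => ?_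
  obtain ⟨L, φ, hφ⟩ := R.alg_mem ω
  refine lintegral_error_ge L k σ hσ k 0 (zero_add k) D a A (fun v => rfl) _
    (measurable_shellWeight _) (fun s hs => (mem_Icc_of_shellWeight_ne_zero hs).2) _
    (hGm.comp measurable_prodMk_right) (fun v v' hv hv' hvv => ?_) _ hx
  have hv := (mem_Icc_of_shellWeight_ne_zero hv).2
  have hv' := (mem_Icc_of_shellWeight_ne_zero hv').2
  have halg : R.alg ω (T v) = R.alg ω (T v') := by
    rw [hφ, hφ, hTv v hv, hTv v' hv', hvv]
  -- Equal information forces equal outputs, which cancel in the difference of the two errors.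
  have h1 : S (A (v - v')) = (S (T v) - R.alg ω (T v)) - (S (T v') - R.alg ω (T v')) := by
    rw [halg, hTv v hv, hTv v' hv', map_sub, map_sub, map_add, map_add]
    abel
  calc ENNReal.ofReal (σ * ‖v - v'‖) ≤ ENNReal.ofReal ‖S (A (v - v'))‖ :=
        ENNReal.ofReal_le_ofReal (hS _)
    _ = ‖S (A (v - v'))‖ₑ := ofReal_norm _
    _ ≤ _ := by rw [h1]; exact enorm_sub_le

end LinInfo

/-! ### Determinant and singular values of a triangular section -/

namespace LinInfo

open MeasureTheory Module

/-- From `m! ≥ (m / e) ^ m` with `m = 2n` and `e < 3`; then `(2n / 3) / 4 = n / 6`. -/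
theorem pow_le_prod_range_div_four (n : ℕ) :
    ((n : ℝ) / 6) ^ (2 * n) ≤ ∏ j ∈ Finset.range (2 * n), (((j : ℝ) + 1) / 4) := by
  have h1 : ∏ j ∈ Finset.range (2 * n), (((j : ℝ) + 1) / 4) =
      ((2 * n).factorial : ℝ) / 4 ^ (2 * n) := by
    rw [Finset.prod_div_distrib, ← Finset.prod_range_add_one_eq_factorial]
    push_cast
    simp
  have h2 := Real.pow_div_factorial_le_exp (x := ((2 * n : ℕ) : ℝ)) (by positivity) (2 * n)
  have h3 : Real.exp ((2 * n : ℕ) : ℝ) ≤ 3 ^ (2 * n) := by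
    rw [← Real.exp_one_pow]
    exact pow_le_pow_left₀ (Real.exp_pos _).le (Real.exp_one_lt_d9.le.trans (by norm_num)) _
  have h4 := h2.trans h3
  rw [div_le_iff₀ (by positivity)] at h4
  rw [h1, le_div_iff₀ (by positivity), ← mul_pow]
  have h5 : (0 : ℝ) < 3 ^ (2 * n) := by positivity
  refine le_of_mul_le_mul_left ?_ h5
  rw [← mul_pow]
  refine le_trans (le_of_eq ?_) h4
  push_cast
  congr 1
  ring

theorem prod_rpow_neg_le (n : ℕ) (hn : 1 ≤ n) {α : ℝ} (hα : 0 < α) :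
    ∏ j ∈ Finset.range (2 * n), (((j : ℝ) + 1) / 4) ^ (-α) ≤ (((n : ℝ) / 6) ^ (-α)) ^ (2 * n) := by
  have hn0 : (0 : ℝ) < n := by exact_mod_cast hn
  rw [Real.finsetProd_rpow _ _ fun i _ => by positivity, ← Real.rpow_natCast _ (2 * n),
    ← Real.rpow_mul (by positivity), mul_comm (-α), Real.rpow_mul (by positivity),
    Real.rpow_natCast]
  exact Real.rpow_le_rpow_of_nonpos (by positivity) (pow_le_prod_range_div_four n) (by linarith)

variable {𝕜 : Type z} {X : Type u} {Y : Type v} [RCLike 𝕜] [NormedAddCommGroup X] [NormedSpace 𝕜 X]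
  [NormedAddCommGroup Y] [NormedSpace 𝕜 Y] [NormedSpace ℝ X]

/-- The linear map sending the standard basis to a given family. -/
noncomputable def euclideanLinearCombination {D : ℕ} (h : Fin D → X) :
    EuclideanSpace ℝ (Fin D) →ₗ[ℝ] X :=
  Fintype.linearCombination ℝ h ∘ₗ (WithLp.linearEquiv 2 ℝ _).toLinearMap

theorem euclideanLinearCombination_apply {D : ℕ} (h : Fin D → X) (v : EuclideanSpace ℝ (Fin D)) :
    euclideanLinearCombination h v = ∑ j, v j • h j := by
  simp [euclideanLinearCombination, Fintype.linearCombination_apply]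

/-- Estimate for the diagonal of a triangular section of `S` by randomized errors. -/
theorem le_of_triangular [IsScalarTower ℝ 𝕜 X] (S : X →L[𝕜] Y) (F : Set X) {n : ℕ} (hn : 1 ≤ n)
    (h : Fin (2 * n) → X) (y : Fin (2 * n) → (Y →L[𝕜] 𝕜)) {ρ : ℝ} (hρ : 0 ≤ ρ)
    (htri : ∀ i j, i < j → y i (S (h j)) = 0) (hdiag : ∀ i, ρ ≤ RCLike.re (y i (S (h i))))
    (c : X) {a b : ℝ} (ha : 0 < a) (hb : 0 < b)
    (hA : ∀ v : EuclideanSpace ℝ (Fin (2 * n)), ‖v‖ ≤ 1 → c + a • ∑ j, v j • h j ∈ F)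
    (hB : ∀ z, ∑ i, RCLike.re (y i z) ^ 2 ≤ b ^ 2 * ‖z‖ ^ 2)
    {α : ℝ} (hα : 0 < α) {s : ℝ} (hs : 0 ≤ s)
    (hran : ∀ k < n, eRan.{w, u, v, z} S F k ≤ ENNReal.ofReal (s * ((k : ℝ) + 1) ^ (-α))) :
    ρ ≤ 2 * (b / a) * s * ((n : ℝ) / 6) ^ (-α) := by
  set H := euclideanLinearCombination h with hH
  let e := (EuclideanSpace.basisFun (Fin (2 * n)) ℝ).toBasis
  let M : Matrix (Fin (2 * n)) (Fin (2 * n)) ℝ := fun i j => RCLike.re (y i (S (h j)))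
  set T := Matrix.toLin e e M with hT
  have hTi : ∀ v i, T v i = RCLike.re (y i (S (H v))) := fun v i => by
    let l : X →ₗ[ℝ] ℝ :=
      RCLike.reLm.comp (((y i).comp S).toLinearMap.restrictScalars ℝ)
    have hl : ∀ x, l x = RCLike.re (y i (S x)) := fun x => rfl
    rw [← hl, hH, euclideanLinearCombination_apply, map_sum]
    simp only [LinearMap.map_smul]
    simp only [hl]
    rw [hT, Matrix.toLin_apply]
    simp [e, M, Matrix.mulVec, dotProduct, mul_comm, Pi.single_apply]
  have hTn : ∀ v, ‖T v‖ ≤ b * ‖S (H v)‖ := fun v => by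
    refine le_of_sq_le_sq ?_ (by positivity)
    rw [EuclideanSpace.real_norm_sq_eq, mul_pow]
    simpa only [hTi] using hB (S (H v))
  have hsv : ∀ j < 2 * n, T.singularValues j ≤
      2 * (b / a) * s * (((j : ℝ) + 1) / 4) ^ (-α) := fun j hj => by
    obtain ⟨q, hq⟩ := exists_isometry_singularValues T j hj
    have h0 := T.singularValues_nonneg j
    -- `j / 4` is the largest `k` with `4k < j + 1`. The factor `a` fits the ball into `F`, and `1 /
    -- b` passes from `T` to `S` via `hTn`.
    have h1 := ofReal_le_eRan.{w} S F (k := j / 4) (D := j + 1) (by omega)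
      (σ := a / b * T.singularValues j) (by positivity) c (a • (H ∘ₗ q.toLinearMap))
      (fun v hv => by
        have := hA (q v) (by rwa [q.norm_map])
        simpa [hH, euclideanLinearCombination_apply] using this)
      (fun v => by
        have e1 : S ((a • (H ∘ₗ q.toLinearMap)) v) = (a : 𝕜) • S (H (q v)) := by
          rw [← map_smul, RCLike.ofReal_alg, smul_assoc, one_smul]
          rfl
        rw [e1, norm_smul, RCLike.norm_ofReal, abs_of_pos ha]
        have := (hq v).trans (hTn (q v))
        calc a / b * T.singularValues j * ‖v‖ = a / b * (T.singularValues j * ‖v‖) := by ring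
          _ ≤ a / b * (b * ‖S (H (q v))‖) := by gcongr
          _ = _ := by field_simp)
    have h2 := h1.trans (hran (j / 4) (by omega))
    rw [ENNReal.ofReal_le_ofReal_iff (by positivity)] at h2
    have h3 : (((j / 4 : ℕ) : ℝ) + 1) ^ (-α) ≤ (((j : ℝ) + 1) / 4) ^ (-α) := by
      refine Real.rpow_le_rpow_of_nonpos (by positivity) ?_ (by linarith)
      have : j + 1 ≤ 4 * (j / 4 + 1) := by omega
      have : ((j : ℝ) + 1) ≤ 4 * (((j / 4 : ℕ) : ℝ) + 1) := by exact_mod_cast this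
      linarith
    calc T.singularValues j = 2 * (b / a) * (a / b * T.singularValues j / 2) := by field_simp
      _ ≤ 2 * (b / a) * (s * (((j : ℝ) + 1) / 4) ^ (-α)) := by gcongr; exact h2.trans (by gcongr)
      _ = _ := by ring
  have hdet : LinearMap.det T = ∏ i, RCLike.re (y i (S (h i))) := by
    rw [hT, LinearMap.det_toLin, Matrix.det_of_isLowerTriangular]
    intro i j hij
    change RCLike.re (y i (S (h j))) = 0
    rw [htri i j hij, map_zero]
  have hpow : ρ ^ (2 * n) ≤ (2 * (b / a) * s * ((n : ℝ) / 6) ^ (-α)) ^ (2 * n) := by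
    calc ρ ^ (2 * n) = ∏ _i : Fin (2 * n), ρ := by simp
      _ ≤ ∏ i, RCLike.re (y i (S (h i))) := Finset.prod_le_prod (fun _ _ => hρ) fun i _ => hdiag i
      _ ≤ |LinearMap.det T| := by rw [hdet]; exact le_abs_self _
      _ = ∏ j ∈ Finset.range (2 * n), T.singularValues j := by
          rw [← LinearMap.normDet_eq_abs_det, LinearMap.normDet_eq_prod_singularValues,
            finrank_euclideanSpace_fin]
      _ ≤ ∏ j ∈ Finset.range (2 * n), (2 * (b / a) * s * (((j : ℝ) + 1) / 4) ^ (-α)) :=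
          Finset.prod_le_prod (fun j _ => T.singularValues_nonneg j) fun j hj =>
            hsv j (Finset.mem_range.1 hj)
      _ = (2 * (b / a) * s) ^ (2 * n) *
            ∏ j ∈ Finset.range (2 * n), (((j : ℝ) + 1) / 4) ^ (-α) := by
          rw [Finset.prod_mul_distrib, Finset.prod_const, Finset.card_range]
      _ ≤ _ := by
          rw [mul_pow _ (((n : ℝ) / 6) ^ (-α))]
          gcongr
          exact prod_rpow_neg_le n hn hα
  exact (pow_le_pow_iff_left₀ hρ (by positivity) (by omega)).1 hpow

end LinInfo

/-! ### Balls inside convex sets and greedy triangular systems -/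

namespace LinInfo

open MeasureTheory Module

/-- Greedy choice: `U` constrains each new element, `R` ties it to all earlier ones. All three
triangular systems are built this way. -/
theorem exists_fin_seq {P : Type*} (U : P → Prop) (R : P → P → Prop) (D : ℕ)
    (h : ∀ j < D, ∀ p : Fin j → P, (∀ i, U (p i)) → ∃ x, U x ∧ ∀ i, R (p i) x) :
    ∃ p : Fin D → P, (∀ i, U (p i)) ∧ ∀ i j, i < j → R (p i) (p j) := by
  induction D with
  | zero => exact ⟨Fin.elim0, fun i => i.elim0, fun i => i.elim0⟩
  | succ D ih =>
    obtain ⟨p, hp, hR⟩ := ih fun j hj => h j (hj.trans (Nat.lt_succ_self D))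
    obtain ⟨x, hx, hxR⟩ := h D (Nat.lt_succ_self D) p hp
    refine ⟨Fin.snoc (α := fun _ => P) p x, fun i => ?_, fun i j hij => ?_⟩
    · refine Fin.lastCases ?_ (fun i => ?_) i
      · simpa using hx
      · simpa using hp i
    · induction j using Fin.lastCases with
      | last =>
        induction i using Fin.lastCases with
        | last => exact absurd hij (lt_irrefl _)
        | cast i => simpa using hxR i
      | cast j =>
        induction i using Fin.lastCases with
        | last => exact absurd hij (not_lt.2 (Fin.le_last _))
        | cast i => simpa using hR i j (by simpa using hij)

/-- A convex set contains a scaled Euclidean ball spanned by half differences of its elements. -/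
theorem convex_add_smul_sum_mem {X : Type*} [AddCommGroup X] [Module ℝ X] {F : Set X}
    (hF : Convex ℝ F) {D : ℕ} (hD : 0 < D) (f g : Fin D → X) (hf : ∀ i, f i ∈ F)
    (hg : ∀ i, g i ∈ F) (v : EuclideanSpace ℝ (Fin D)) (hv : ‖v‖ ≤ 1) :
    (∑ j, (D : ℝ)⁻¹ • (1 / 2 : ℝ) • (f j + g j)) +
      (D : ℝ)⁻¹ • ∑ j, v j • (1 / 2 : ℝ) • (f j - g j) ∈ F := by
  have hD0 : (D : ℝ) ≠ 0 := by positivity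
  -- Without symmetry, each coordinate moves only along the segment from `g j` to `f j`, and
  -- averaging the `D` segments costs the factor `D`.
  have e : (∑ j, (D : ℝ)⁻¹ • (1 / 2 : ℝ) • (f j + g j)) +
      (D : ℝ)⁻¹ • ∑ j, v j • (1 / 2 : ℝ) • (f j - g j) =
      ∑ j, (D : ℝ)⁻¹ • (((1 + v j) / 2) • f j + ((1 - v j) / 2) • g j) := by
    rw [Finset.smul_sum, ← Finset.sum_add_distrib]
    refine Finset.sum_congr rfl fun j _ => ?_
    module
  rw [e]
  refine hF.sum_mem (fun _ _ => by positivity) (by simp [hD0]) fun j _ => ?_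
  have h1 : |v j| ≤ 1 := (PiLp.norm_apply_le v j).trans hv
  rw [abs_le] at h1
  exact hF (hf j) (hg j) (by linarith) (by linarith) (by ring)

/-- A symmetric convex set contains a scaled Euclidean ball spanned by its elements. -/
theorem convex_smul_sum_mem {X : Type*} [AddCommGroup X] [Module ℝ X] {F : Set X}
    (hF : Convex ℝ F) (hsymm : -F = F) {D : ℕ} (hD : 0 < D) (h : Fin D → X) (hh : ∀ i, h i ∈ F)
    (v : EuclideanSpace ℝ (Fin D)) (hv : ‖v‖ ≤ 1) :
    (0 : X) + (Real.sqrt D)⁻¹ • ∑ j, v j • h j ∈ F := by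
  have hneg : ∀ x ∈ F, -x ∈ F := fun x hx => by rw [← hsymm]; simpa using hx
  have hzero : (0 : X) ∈ F := by
    have := hF (hh ⟨0, hD⟩) (hneg _ (hh ⟨0, hD⟩)) (a := 1 / 2) (b := 1 / 2)
      (by norm_num) (by norm_num) (by norm_num)
    simpa using this
  have hsD : 0 < Real.sqrt D := Real.sqrt_pos.2 (by exact_mod_cast hD)
  -- Cauchy–Schwarz bounds the `ℓ¹` norm by `√D` times the `ℓ²` norm, hence radius `1/√D` suffices.
  have hsum : ∑ j, (Real.sqrt D)⁻¹ * |v j| ≤ 1 := by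
    rw [← Finset.mul_sum, inv_mul_le_one₀ hsD]
    refine Real.le_sqrt_of_sq_le ?_
    have h1 := sq_sum_le_card_mul_sum_sq (s := Finset.univ) (f := fun j => |v j|)
    simp only [Finset.card_univ, Fintype.card_fin, sq_abs] at h1
    rw [← EuclideanSpace.real_norm_sq_eq] at h1
    refine h1.trans (mul_le_of_le_one_right (by positivity) ?_)
    exact pow_le_one₀ (norm_nonneg v) hv
  -- The unused weight is placed at `0 ∈ F`; signs are absorbed into `± h j`.
  let c : Option (Fin D) → ℝ := fun o => o.elim (1 - ∑ j, (Real.sqrt D)⁻¹ * |v j|)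
    fun j => (Real.sqrt D)⁻¹ * |v j|
  let x : Option (Fin D) → X := fun o => o.elim 0 fun j => if 0 ≤ v j then h j else -h j
  have hmem : ∑ o, c o • x o ∈ F := by
    refine hF.sum_mem (fun o _ => ?_) ?_ fun o _ => ?_
    · cases o with
      | none => exact sub_nonneg.2 hsum
      | some j => exact mul_nonneg (by positivity) (abs_nonneg _)
    · simp [c, Fintype.sum_option]
    · cases o with
      | none => exact hzero
      | some j =>
        simp only [x, Option.elim]
        split_ifs
        · exact hh j
        · exact hneg _ (hh j)
  convert hmem using 1
  rw [zero_add, Fintype.sum_option, Finset.smul_sum]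
  simp only [c, x, Option.elim, smul_zero, zero_add]
  refine Finset.sum_congr rfl fun j _ => ?_
  split_ifs with hj
  · rw [abs_of_nonneg hj, smul_smul]
  · rw [abs_of_neg (not_le.1 hj), smul_smul]
    simp

variable {𝕜 : Type z} {X : Type u} {Y : Type v} [RCLike 𝕜] [NormedAddCommGroup X] [NormedSpace 𝕜 X]
  [NormedAddCommGroup Y] [NormedSpace 𝕜 Y]

/-- Fewer than `eDetNon` many functionals leave a large ambiguity. -/
theorem exists_lt_norm_sub_of_lt_eDetNon (S : X →L[𝕜] Y) (F : Set X) {N : ℕ} {r : ℝ}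
    (hr : ENNReal.ofReal r < eDetNon S F N) {ι : Type*} [Fintype ι] (L : ι → (X →L[𝕜] 𝕜))
    (hι : Fintype.card ι ≤ N) :
    ∃ f ∈ F, ∃ g ∈ F, (∀ i, L i (f - g) = 0) ∧ r < ‖S (f - g)‖ := by
  classical
  by_contra! hcon
  refine absurd hr (not_lt.2 ?_)
  let L' : Fin N → (X →L[𝕜] 𝕜) := fun m =>
    if h : (m : ℕ) < Fintype.card ι then L ((Fintype.equivFin ι).symm ⟨m, h⟩) else 0
  -- Returning `S g` for any `g ∈ F` consistent with the data would have error at most `r` if the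
  -- claim failed.
  let φ : (Fin N → 𝕜) → Y := fun t =>
    if h : ∃ g ∈ F, (fun i => L' i g) = t then S h.choose else 0
  refine (iInf₂_le (fun f : F => φ fun i => L' i f) ⟨L', φ, fun f => rfl⟩).trans ?_
  refine iSup_le fun f => ?_
  have hex : ∃ g ∈ F, (fun i => L' i g) = fun i => L' i (f : X) := ⟨f, f.2, rfl⟩
  simp only [φ, dif_pos hex]
  rw [← ofReal_norm, ← map_sub]
  refine ENNReal.ofReal_le_ofReal (hcon _ f.2 _ hex.choose_spec.1 fun i => ?_)
  have h1 := congrFun hex.choose_spec.2 ⟨Fintype.equivFin ι i, (Fin.is_lt _).trans_le hι⟩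
  have h2 : L' ⟨Fintype.equivFin ι i, (Fin.is_lt _).trans_le hι⟩ = L i := by simp [L']
  rw [h2] at h1
  rw [map_sub, ← h1, sub_self]

theorem map_real_smul_eq [NormedSpace ℝ X] [IsScalarTower ℝ 𝕜 X] (S : X →L[𝕜] Y) (r : ℝ) (x : X) :
    S (r • x) = (r : 𝕜) • S x := by
  rw [← map_smul, RCLike.ofReal_alg, smul_assoc, one_smul]

/-- The functionals `y i ∘ S` of the earlier steps serve as information, at most `D - 1 ≤ N` of
them; the new `y` norms the new image under `S`. -/
theorem exists_triangular [NormedSpace ℝ X] [IsScalarTower ℝ 𝕜 X] (S : X →L[𝕜] Y) (F : Set X)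
    {N : ℕ} {ρ : ℝ} (hr : ENNReal.ofReal (2 * ρ) < eDetNon S F N) {D : ℕ} (hD : D ≤ N + 1) :
    ∃ (f g : Fin D → X) (y : Fin D → (Y →L[𝕜] 𝕜)), (∀ i, f i ∈ F) ∧ (∀ i, g i ∈ F) ∧
      (∀ i, ‖y i‖ ≤ 1) ∧
      (∀ i, ρ ≤ RCLike.re (y i (S ((1 / 2 : ℝ) • (f i - g i))))) ∧
      ∀ i j, i < j → y i (S ((1 / 2 : ℝ) • (f j - g j))) = 0 := by
  obtain ⟨p, hU, hR⟩ := exists_fin_seq (P := X × X × (Y →L[𝕜] 𝕜))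
    (fun p => p.1 ∈ F ∧ p.2.1 ∈ F ∧ ‖p.2.2‖ ≤ 1 ∧
      ρ ≤ RCLike.re (p.2.2 (S ((1 / 2 : ℝ) • (p.1 - p.2.1)))))
    (fun p q => p.2.2 (S ((1 / 2 : ℝ) • (q.1 - q.2.1))) = 0) D (fun j hj p hp => by
      obtain ⟨f, hf, g, hg, hL, hlt⟩ := exists_lt_norm_sub_of_lt_eDetNon S F hr
        (fun i : Fin j => (p i).2.2.comp S) (by rw [Fintype.card_fin]; omega)
      obtain ⟨y, hy1, hy⟩ := exists_dual_vector'' 𝕜 (S ((1 / 2 : ℝ) • (f - g)))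
      refine ⟨(f, g, y), ⟨hf, hg, hy1, ?_⟩, fun i => ?_⟩
      · simp only [hy, RCLike.ofReal_re]
        rw [map_real_smul_eq, norm_smul, RCLike.norm_ofReal, abs_of_pos (by norm_num)]
        linarith
      · have := hL i
        simp only [ContinuousLinearMap.comp_apply] at this
        simp only [map_real_smul_eq, map_smul, this, smul_zero])
  exact ⟨fun i => (p i).1, fun i => (p i).2.1, fun i => (p i).2.2, fun i => (hU i).1,
    fun i => (hU i).2.1, fun i => (hU i).2.2.1, fun i => (hU i).2.2.2, hR⟩

/-- In a Hilbert space the image `S h` is a positive multiple of its own norming direction, so the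
triangular relations already make these directions orthogonal. -/
theorem exists_triangular_orthonormal {Y : Type*} [NormedAddCommGroup Y] [InnerProductSpace 𝕜 Y]
    [NormedSpace ℝ X] [IsScalarTower ℝ 𝕜 X] (S : X →L[𝕜] Y) (F : Set X)
    {N : ℕ} {ρ : ℝ} (hρ : 0 ≤ ρ) (hr : ENNReal.ofReal (2 * ρ) < eDetNon S F N) {D : ℕ}
    (hD : D ≤ N + 1) :
    ∃ (f g : Fin D → X) (e : Fin D → Y), (∀ i, f i ∈ F) ∧ (∀ i, g i ∈ F) ∧ Orthonormal 𝕜 e ∧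
      (∀ i, ρ ≤ RCLike.re (innerSL 𝕜 (e i) (S ((1 / 2 : ℝ) • (f i - g i))))) ∧
      ∀ i j, i < j → innerSL 𝕜 (e i) (S ((1 / 2 : ℝ) • (f j - g j))) = 0 := by
  obtain ⟨p, hU, hR⟩ := exists_fin_seq (P := X × X × Y)
    (fun p => p.1 ∈ F ∧ p.2.1 ∈ F ∧ ‖p.2.2‖ = 1 ∧
      ∃ r : ℝ, ρ < r ∧ S ((1 / 2 : ℝ) • (p.1 - p.2.1)) = (r : 𝕜) • p.2.2)
    (fun p q => inner 𝕜 p.2.2 (S ((1 / 2 : ℝ) • (q.1 - q.2.1))) = 0) D (fun j hj p hp => by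
      obtain ⟨f, hf, g, hg, hL, hlt⟩ := exists_lt_norm_sub_of_lt_eDetNon S F hr
        (fun i : Fin j => (innerSL 𝕜 (p i).2.2).comp S) (by rw [Fintype.card_fin]; omega)
      set t := S ((1 / 2 : ℝ) • (f - g)) with ht
      have hlt' : ρ < ‖t‖ := by
        rw [ht, map_real_smul_eq, norm_smul, RCLike.norm_ofReal, abs_of_pos (by norm_num)]
        linarith
      have ht0 : t ≠ 0 := norm_pos_iff.1 (hρ.trans_lt hlt')
      have ht0' : (‖t‖ : 𝕜) ≠ 0 := by exact_mod_cast norm_ne_zero_iff.2 ht0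
      refine ⟨(f, g, (‖t‖ : 𝕜)⁻¹ • t), ⟨hf, hg, norm_smul_inv_norm ht0, ‖t‖, hlt', ?_⟩,
        fun i => ?_⟩
      · rw [smul_smul, mul_inv_cancel₀ ht0', one_smul]
      · have := hL i
        simp only [ContinuousLinearMap.comp_apply, innerSL_apply_apply] at this
        simp only [map_real_smul_eq, inner_smul_right, this, mul_zero])
  have horth : ∀ i j, i < j → inner 𝕜 (p i).2.2 (p j).2.2 = 0 := fun i j hij => by
    obtain ⟨r, hr, h⟩ := (hU j).2.2.2
    have h1 := hR i j hij
    rw [h, inner_smul_right] at h1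
    have hr0 : (r : 𝕜) ≠ 0 := by exact_mod_cast (hρ.trans_lt hr).ne'
    exact (mul_eq_zero.1 h1).resolve_left hr0
  refine ⟨fun i => (p i).1, fun i => (p i).2.1, fun i => (p i).2.2, fun i => (hU i).1,
    fun i => (hU i).2.1, ⟨fun i => (hU i).2.2.1, fun i j hij => ?_⟩, fun i => ?_, hR⟩
  · rcases lt_or_gt_of_ne hij with h | h
    · exact horth i j h
    · exact inner_eq_zero_symm.1 (horth j i h)
  · obtain ⟨r, hr, h⟩ := (hU i).2.2.2
    rw [h, innerSL_apply_apply, inner_smul_right, inner_self_eq_norm_sq_to_K, (hU i).2.2.1]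
    simpa using hr.le

/-- Inner products with the earlier `h i` are added to the information, so each earlier index costs
two functionals. As `‖f - g‖ ≤ 2`, normalizing loses no more than halving. -/
theorem exists_triangular_closedBall {X : Type*} [NormedAddCommGroup X] [InnerProductSpace 𝕜 X]
    (S : X →L[𝕜] Y) {N : ℕ} {ρ : ℝ} (hρ : 0 ≤ ρ)
    (hr : ENNReal.ofReal (2 * ρ) < eDetNon S (Metric.closedBall (0 : X) 1) N) {D : ℕ}
    (hD : 2 * D ≤ N + 2) :
    ∃ (h : Fin D → X) (y : Fin D → (Y →L[𝕜] 𝕜)), Orthonormal 𝕜 h ∧ (∀ i, ‖y i‖ ≤ 1) ∧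
      (∀ i, ρ ≤ RCLike.re (y i (S (h i)))) ∧ ∀ i j, i < j → y i (S (h j)) = 0 := by
  obtain ⟨p, hU, hR⟩ := exists_fin_seq (P := X × (Y →L[𝕜] 𝕜))
    (fun p => ‖p.1‖ = 1 ∧ ‖p.2‖ ≤ 1 ∧ ρ ≤ RCLike.re (p.2 (S p.1)))
    (fun p q => inner 𝕜 p.1 q.1 = 0 ∧ p.2 (S q.1) = 0) D (fun j hj p hp => by
      obtain ⟨f, hf, g, hg, hL, hlt⟩ := exists_lt_norm_sub_of_lt_eDetNon S _ hr
        (Sum.elim (fun i : Fin j => (p i).2.comp S) (fun i : Fin j => innerSL 𝕜 (p i).1))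
        (by rw [Fintype.card_sum, Fintype.card_fin]; omega)
      have hL1 : ∀ i, (p i).2 (S (f - g)) = 0 := fun i => hL (Sum.inl i)
      have hL2 : ∀ i, inner 𝕜 (p i).1 (f - g) = 0 := fun i => hL (Sum.inr i)
      have ht2 : ‖f - g‖ ≤ 2 := by
        rw [mem_closedBall_zero_iff] at hf hg
        linarith [norm_sub_le f g]
      set t := f - g
      have ht0 : t ≠ 0 := fun h0 => by
        rw [h0, map_zero, norm_zero] at hlt
        linarith
      have htpos : 0 < ‖t‖ := norm_pos_iff.2 ht0
      obtain ⟨y, hy1, hy⟩ := exists_dual_vector'' 𝕜 (S ((‖t‖ : 𝕜)⁻¹ • t))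
      refine ⟨((‖t‖ : 𝕜)⁻¹ • t, y), ⟨norm_smul_inv_norm ht0, hy1, ?_⟩, fun i => ⟨?_, ?_⟩⟩
      · simp only [hy, RCLike.ofReal_re]
        rw [map_smul, norm_smul, norm_inv, RCLike.norm_ofReal, abs_norm, ← div_eq_inv_mul,
          le_div_iff₀ htpos]
        nlinarith
      · simp only [inner_smul_right, hL2, mul_zero]
      · simp only [map_smul, hL1, smul_zero])
  have horth : ∀ i j, i < j → inner 𝕜 (p i).1 (p j).1 = 0 := fun i j hij => (hR i j hij).1
  refine ⟨fun i => (p i).1, fun i => (p i).2, ⟨fun i => (hU i).1, fun i j hij => ?_⟩,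
    fun i => (hU i).2.1, fun i => (hU i).2.2, fun i j hij => (hR i j hij).2⟩
  rcases lt_or_gt_of_ne hij with h | h
  · exact horth i j h
  · exact inner_eq_zero_symm.1 (horth j i h)

end LinInfo

/-! ### Constants and the individual cases -/

namespace LinInfo

open MeasureTheory Module

theorem norm_sum_smul_of_orthonormal {𝕜 X ι : Type*} [RCLike 𝕜] [Fintype ι]
    [NormedAddCommGroup X] [InnerProductSpace 𝕜 X] [NormedSpace ℝ X] [IsScalarTower ℝ 𝕜 X]
    {h : ι → X} (hh : Orthonormal 𝕜 h) (v : EuclideanSpace ℝ ι) :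
    ‖∑ j, v j • h j‖ = ‖v‖ := by
  have e : ∑ j, v j • h j = ∑ j, (v j : 𝕜) • h j := Finset.sum_congr rfl fun j _ => by
    rw [RCLike.ofReal_alg, smul_assoc, one_smul]
  rw [e, ← pow_left_inj₀ (norm_nonneg _) (norm_nonneg _) two_ne_zero,
    EuclideanSpace.real_norm_sq_eq, ← RCLike.ofReal_inj (K := 𝕜)]
  push_cast
  rw [← inner_self_eq_norm_sq_to_K, hh.inner_sum]
  exact Finset.sum_congr rfl fun j _ => by rw [RCLike.conj_ofReal, sq]

variable {𝕜 : Type z} {X : Type u} {Y : Type v} [RCLike 𝕜] [NormedAddCommGroup X] [NormedSpace 𝕜 X]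
  [NormedAddCommGroup Y] [NormedSpace 𝕜 Y]

theorem sum_re_sq_le {D : ℕ} (y : Fin D → (Y →L[𝕜] 𝕜)) (hy : ∀ i, ‖y i‖ ≤ 1) (x : Y) :
    ∑ i, RCLike.re (y i x) ^ 2 ≤ Real.sqrt D ^ 2 * ‖x‖ ^ 2 := by
  rw [Real.sq_sqrt D.cast_nonneg]
  have h1 : ∀ i ∈ Finset.univ, RCLike.re (y i x) ^ 2 ≤ ‖x‖ ^ 2 := fun i _ => by
    rw [← sq_abs]
    refine pow_le_pow_left₀ (abs_nonneg _) ?_ 2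
    refine (RCLike.abs_re_le_norm _).trans (((y i).le_opNorm x).trans ?_)
    exact mul_le_of_le_one_left (norm_nonneg x) (hy i)
  simpa using Finset.sum_le_sum h1

theorem sum_re_inner_sq_le {Y : Type*} [NormedAddCommGroup Y] [InnerProductSpace 𝕜 Y] {D : ℕ}
    {e : Fin D → Y} (he : Orthonormal 𝕜 e) (x : Y) :
    ∑ i, RCLike.re (innerSL 𝕜 (e i) x) ^ 2 ≤ 1 ^ 2 * ‖x‖ ^ 2 := by
  rw [one_pow, one_mul]
  refine le_trans (Finset.sum_le_sum fun i _ => ?_) (he.sum_inner_products_le x (s := Finset.univ))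
  rw [← sq_abs, innerSL_apply_apply]
  exact pow_le_pow_left₀ (abs_nonneg _) (RCLike.abs_re_le_norm _) 2

variable [NormedSpace ℝ X]

/-- `H` is applied with `2ρ` any value below `eDetNon` and `s` the weighted supremum. The constant
comes from `4 · 2 ^ β ≤ 12` for `β ≤ 3/2` and `6 ^ α ≤ 12 ^ α`. -/
theorem eDetNon_le_of_forall_le (S : X →L[𝕜] Y) (F : Set X) {n N : ℕ} (hn : 1 ≤ n) {α : ℝ}
    (hα : 0 < α) {β : ℝ} (hβ : β ≤ 3 / 2)
    (H : ∀ ρ s : ℝ, 0 ≤ ρ → 0 ≤ s → ENNReal.ofReal (2 * ρ) < eDetNon S F N →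
      (∀ k < n, eRan.{w, u, v, z} S F k ≤ ENNReal.ofReal (s * ((k : ℝ) + 1) ^ (-α))) →
      ρ ≤ 2 * (2 * n : ℝ) ^ β * s * ((n : ℝ) / 6) ^ (-α)) :
    eDetNon S F N ≤ ENNReal.ofReal ((12 : ℝ) ^ (α + 1) * (n : ℝ) ^ (-α + β)) *
      ⨆ k ∈ Finset.range n, ENNReal.ofReal (((k : ℝ) + 1) ^ α) * eRan.{w, u, v, z} S F k := by
  have hn0 : (0 : ℝ) < n := by exact_mod_cast hn
  set T := ⨆ k ∈ Finset.range n, ENNReal.ofReal (((k : ℝ) + 1) ^ α) * eRan.{w, u, v, z} S F k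
    with hT
  have hC : 0 < (12 : ℝ) ^ (α + 1) * (n : ℝ) ^ (-α + β) := by positivity
  rcases eq_or_ne T ∞ with hTt | hTt
  · rw [hTt, ENNReal.mul_top (ENNReal.ofReal_pos.2 hC).ne']
    exact le_top
  have hran : ∀ k < n, eRan.{w, u, v, z} S F k ≤
      ENNReal.ofReal (T.toReal * ((k : ℝ) + 1) ^ (-α)) := fun k hk => by
    have h1 : ENNReal.ofReal (((k : ℝ) + 1) ^ α) * eRan.{w, u, v, z} S F k ≤ T :=
      le_iSup₂ (f := fun k (_ : k ∈ Finset.range n) =>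
        ENNReal.ofReal (((k : ℝ) + 1) ^ α) * eRan.{w, u, v, z} S F k) k (Finset.mem_range.2 hk)
    rw [mul_comm T.toReal, ENNReal.ofReal_mul (by positivity), ENNReal.ofReal_toReal hTt]
    refine le_trans (le_of_eq ?_) (mul_le_mul_right h1 _)
    rw [← mul_assoc, ← ENNReal.ofReal_mul (by positivity), ← Real.rpow_add (by positivity),
      neg_add_cancel, Real.rpow_zero, ENNReal.ofReal_one, one_mul]
  refine le_of_forall_lt_imp_le_of_dense fun c hc => ?_
  have hct : c ≠ ∞ := (hc.trans_le le_top).ne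
  have hle := H (c.toReal / 2) T.toReal (by positivity) ENNReal.toReal_nonneg
    (by rwa [mul_div_cancel₀ _ two_ne_zero, ENNReal.ofReal_toReal hct]) hran
  rw [← ENNReal.ofReal_toReal hct, ← ENNReal.ofReal_toReal hTt, ← ENNReal.ofReal_mul hC.le]
  refine ENNReal.ofReal_le_ofReal ?_
  have h2 : (2 : ℝ) ^ β ≤ 3 := by
    have h3 : (2 : ℝ) ^ β ≤ 2 ^ (3 / 2 : ℝ) := Real.rpow_le_rpow_of_exponent_le one_le_two hβ
    refine h3.trans (le_of_sq_le_sq ?_ (by norm_num))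
    rw [← Real.rpow_natCast, ← Real.rpow_mul zero_le_two]
    norm_num
  have h6 : (6 : ℝ) ^ α ≤ 12 ^ α := Real.rpow_le_rpow (by norm_num) (by norm_num) hα.le
  have hsplit : ((n : ℝ) / 6) ^ (-α) = (n : ℝ) ^ (-α) * 6 ^ α := by
    rw [Real.div_rpow hn0.le (by norm_num), Real.rpow_neg (by norm_num : (0 : ℝ) ≤ 6), div_inv_eq_mul]
  calc c.toReal = 2 * (c.toReal / 2) := by ring
    _ ≤ 2 * (2 * (2 * n : ℝ) ^ β * T.toReal * ((n : ℝ) / 6) ^ (-α)) := by gcongr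
    _ = 4 * 2 ^ β * 6 ^ α * ((n : ℝ) ^ (-α) * (n : ℝ) ^ β) * T.toReal := by
        rw [hsplit, Real.mul_rpow zero_le_two hn0.le]
        ring
    _ ≤ 4 * 3 * 12 ^ α * ((n : ℝ) ^ (-α) * (n : ℝ) ^ β) * T.toReal := by gcongr
    _ = _ := by
        rw [Real.rpow_add hn0, Real.rpow_add (by norm_num : (0 : ℝ) < 12), Real.rpow_one]
        ring

theorem two_mul_rpow_one_half (n : ℕ) : (2 * n : ℝ) ^ (1 / 2 : ℝ) = Real.sqrt ((2 * n : ℕ) : ℝ) := by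
  rw [← Real.sqrt_eq_rpow]
  push_cast
  rfl

variable [IsScalarTower ℝ 𝕜 X]

theorem eDetNon_le_of_convex (S : X →L[𝕜] Y) (F : Set X) (hF : Convex ℝ F) {n : ℕ} (hn : 1 ≤ n)
    {α : ℝ} (hα : 0 < α) :
    eDetNon S F (2 * n - 1) ≤ ENNReal.ofReal ((12 : ℝ) ^ (α + 1) * (n : ℝ) ^ (-α + 3 / 2)) *
      ⨆ k ∈ Finset.range n, ENNReal.ofReal (((k : ℝ) + 1) ^ α) * eRan.{w, u, v, z} S F k := by
  refine eDetNon_le_of_forall_le S F hn hα le_rfl fun ρ s hρ hs hlt hran => ?_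
  have hn0 : (0 : ℝ) < n := by exact_mod_cast hn
  obtain ⟨f, g, y, hf, hg, hy, hdiag, htri⟩ := exists_triangular S F hlt (D := 2 * n) (by omega)
  have h := le_of_triangular S F hn _ y hρ htri hdiag _ (a := ((2 * n : ℕ) : ℝ)⁻¹)
    (b := Real.sqrt ((2 * n : ℕ) : ℝ)) (by positivity) (by positivity)
    (convex_add_smul_sum_mem hF (by omega) f g hf hg) (sum_re_sq_le y hy) hα hs hran
  refine h.trans (le_of_eq ?_)
  rw [show (3 / 2 : ℝ) = 1 / 2 + 1 by norm_num, Real.rpow_add (by positivity),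
    two_mul_rpow_one_half, Real.rpow_one, div_inv_eq_mul]
  push_cast
  rfl

theorem half_sub_mem {F : Set X} (hF : Convex ℝ F) (hsymm : -F = F) {f g : X} (hf : f ∈ F)
    (hg : g ∈ F) : (1 / 2 : ℝ) • (f - g) ∈ F := by
  have hg' : -g ∈ F := by rw [← hsymm]; simpa using hg
  rw [sub_eq_add_neg, smul_add]
  exact hF hf hg' (by norm_num) (by norm_num) (by norm_num)

theorem eDetNon_le_of_symmetric (S : X →L[𝕜] Y) (F : Set X) (hF : Convex ℝ F) (hsymm : -F = F)
    {n : ℕ} (hn : 1 ≤ n) {α : ℝ} (hα : 0 < α) :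
    eDetNon S F (2 * n - 1) ≤ ENNReal.ofReal ((12 : ℝ) ^ (α + 1) * (n : ℝ) ^ (-α + 1)) *
      ⨆ k ∈ Finset.range n, ENNReal.ofReal (((k : ℝ) + 1) ^ α) * eRan.{w, u, v, z} S F k := by
  refine eDetNon_le_of_forall_le S F hn hα (by norm_num) fun ρ s hρ hs hlt hran => ?_
  have hn0 : (0 : ℝ) < n := by exact_mod_cast hn
  obtain ⟨f, g, y, hf, hg, hy, hdiag, htri⟩ := exists_triangular S F hlt (D := 2 * n) (by omega)
  have h := le_of_triangular S F hn _ y hρ htri hdiag _ (a := (Real.sqrt ((2 * n : ℕ) : ℝ))⁻¹)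
    (b := Real.sqrt ((2 * n : ℕ) : ℝ)) (by positivity) (by positivity)
    (convex_smul_sum_mem hF hsymm (by omega) _ fun i => half_sub_mem hF hsymm (hf i) (hg i))
    (sum_re_sq_le y hy) hα hs hran
  refine h.trans (le_of_eq ?_)
  rw [Real.rpow_one, div_inv_eq_mul, Real.mul_self_sqrt (by positivity)]
  push_cast
  rfl

theorem eDetNon_le_of_inner {Y : Type v} [NormedAddCommGroup Y] [InnerProductSpace 𝕜 Y]
    (S : X →L[𝕜] Y) (F : Set X) (hF : Convex ℝ F) {n : ℕ} (hn : 1 ≤ n) {α : ℝ} (hα : 0 < α) :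
    eDetNon S F (2 * n - 1) ≤ ENNReal.ofReal ((12 : ℝ) ^ (α + 1) * (n : ℝ) ^ (-α + 1)) *
      ⨆ k ∈ Finset.range n, ENNReal.ofReal (((k : ℝ) + 1) ^ α) * eRan.{w, u, v, z} S F k := by
  refine eDetNon_le_of_forall_le S F hn hα (by norm_num) fun ρ s hρ hs hlt hran => ?_
  have hn0 : (0 : ℝ) < n := by exact_mod_cast hn
  obtain ⟨f, g, e, hf, hg, he, hdiag, htri⟩ :=
    exists_triangular_orthonormal S F hρ hlt (D := 2 * n) (by omega)
  have h := le_of_triangular S F hn _ _ hρ htri hdiag _ (a := ((2 * n : ℕ) : ℝ)⁻¹)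
    (b := 1) (by positivity) one_pos
    (convex_add_smul_sum_mem hF (by omega) f g hf hg) (sum_re_inner_sq_le he) hα hs hran
  refine h.trans (le_of_eq ?_)
  rw [Real.rpow_one, one_div, inv_inv]
  push_cast
  rfl

theorem eDetNon_le_of_symmetric_of_inner {Y : Type v} [NormedAddCommGroup Y]
    [InnerProductSpace 𝕜 Y] (S : X →L[𝕜] Y) (F : Set X) (hF : Convex ℝ F) (hsymm : -F = F)
    {n : ℕ} (hn : 1 ≤ n) {α : ℝ} (hα : 0 < α) :
    eDetNon S F (2 * n - 1) ≤ ENNReal.ofReal ((12 : ℝ) ^ (α + 1) * (n : ℝ) ^ (-α + 1 / 2)) *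
      ⨆ k ∈ Finset.range n, ENNReal.ofReal (((k : ℝ) + 1) ^ α) * eRan.{w, u, v, z} S F k := by
  refine eDetNon_le_of_forall_le S F hn hα (by norm_num) fun ρ s hρ hs hlt hran => ?_
  have hn0 : (0 : ℝ) < n := by exact_mod_cast hn
  obtain ⟨f, g, e, hf, hg, he, hdiag, htri⟩ :=
    exists_triangular_orthonormal S F hρ hlt (D := 2 * n) (by omega)
  have h := le_of_triangular S F hn _ _ hρ htri hdiag _ (a := (Real.sqrt ((2 * n : ℕ) : ℝ))⁻¹)
    (b := 1) (by positivity) one_pos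
    (convex_smul_sum_mem hF hsymm (by omega) _ fun i => half_sub_mem hF hsymm (hf i) (hg i))
    (sum_re_inner_sq_le he) hα hs hran
  refine h.trans (le_of_eq ?_)
  rw [two_mul_rpow_one_half, one_div, inv_inv]

theorem eDetNon_closedBall_le {X : Type u} [NormedAddCommGroup X] [InnerProductSpace 𝕜 X]
    [NormedSpace ℝ X] [IsScalarTower ℝ 𝕜 X] (S : X →L[𝕜] Y) {n : ℕ} (hn : 1 ≤ n) {α : ℝ}
    (hα : 0 < α) :
    eDetNon S (Metric.closedBall (0 : X) 1) (4 * n - 1) ≤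
      ENNReal.ofReal ((12 : ℝ) ^ (α + 1) * (n : ℝ) ^ (-α + 1 / 2)) *
        ⨆ k ∈ Finset.range n, ENNReal.ofReal (((k : ℝ) + 1) ^ α) *
          eRan.{w, u, v, z} S (Metric.closedBall (0 : X) 1) k := by
  refine eDetNon_le_of_forall_le S _ hn hα (by norm_num) fun ρ s hρ hs hlt hran => ?_
  have hn0 : (0 : ℝ) < n := by exact_mod_cast hn
  obtain ⟨x, y, hx, hy, hdiag, htri⟩ :=
    exists_triangular_closedBall S hρ hlt (D := 2 * n) (by omega)
  have h := le_of_triangular S _ hn x y hρ htri hdiag 0 (a := 1)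
    (b := Real.sqrt ((2 * n : ℕ) : ℝ)) one_pos (by positivity)
    (fun v hv => by
      rwa [zero_add, one_smul, mem_closedBall_zero_iff, norm_sum_smul_of_orthonormal hx])
    (sum_re_sq_le y hy) hα hs hran
  refine h.trans (le_of_eq ?_)
  rw [two_mul_rpow_one_half, div_one]

end LinInfo

theorem mainTheorem7 {𝕜 : Type z} [RCLike 𝕜]
    {X : Type u} [NormedAddCommGroup X] [NormedSpace 𝕜 X] [NormedSpace ℝ X] [IsScalarTower ℝ 𝕜 X]
    [CompleteSpace X]
    {Y : Type v} [NormedAddCommGroup Y] [NormedSpace 𝕜 Y] [CompleteSpace Y]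
    (S : X →L[𝕜] Y) (F : Set X) (hF : Convex ℝ F) (n : ℕ) (hn : 1 ≤ n) (α : ℝ) (hα : 0 < α) :
    -- general convex `F`
    (LinInfo.eDetNon S F (2 * n - 1) ≤
      ENNReal.ofReal ((12 : ℝ) ^ (α + 1) * (n : ℝ) ^ (-α + 3 / 2)) *
        ⨆ k ∈ Finset.range n,
          ENNReal.ofReal (((k : ℝ) + 1) ^ α) * LinInfo.eRan.{w, u, v, z} S F k) ∧
    -- `F` symmetric
    (-F = F →
      LinInfo.eDetNon S F (2 * n - 1) ≤
        ENNReal.ofReal ((12 : ℝ) ^ (α + 1) * (n : ℝ) ^ (-α + 1)) *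
          ⨆ k ∈ Finset.range n,
            ENNReal.ofReal (((k : ℝ) + 1) ^ α) * LinInfo.eRan.{w, u, v, z} S F k) ∧
    -- `Y` a Hilbert space
    (LinInfo.IsInnerProductNorm 𝕜 Y →
      LinInfo.eDetNon S F (2 * n - 1) ≤
        ENNReal.ofReal ((12 : ℝ) ^ (α + 1) * (n : ℝ) ^ (-α + 1)) *
          ⨆ k ∈ Finset.range n,
            ENNReal.ofReal (((k : ℝ) + 1) ^ α) * LinInfo.eRan.{w, u, v, z} S F k) ∧
    -- `F` symmetric and `Y` a Hilbert space
    (-F = F → LinInfo.IsInnerProductNorm 𝕜 Y →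
      LinInfo.eDetNon S F (2 * n - 1) ≤
        ENNReal.ofReal ((12 : ℝ) ^ (α + 1) * (n : ℝ) ^ (-α + 1 / 2)) *
          ⨆ k ∈ Finset.range n,
            ENNReal.ofReal (((k : ℝ) + 1) ^ α) * LinInfo.eRan.{w, u, v, z} S F k) ∧
    -- `X` a Hilbert space and `F` its unit ball
    (LinInfo.IsInnerProductNorm 𝕜 X → F = Metric.closedBall (0 : X) 1 →
      LinInfo.eDetNon S F (4 * n - 1) ≤
        ENNReal.ofReal ((12 : ℝ) ^ (α + 1) * (n : ℝ) ^ (-α + 1 / 2)) *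
          ⨆ k ∈ Finset.range n,
            ENNReal.ofReal (((k : ℝ) + 1) ^ α) * LinInfo.eRan.{w, u, v, z} S F k) := by
  refine ⟨LinInfo.eDetNon_le_of_convex S F hF hn hα,
    fun hsymm => LinInfo.eDetNon_le_of_symmetric S F hF hsymm hn hα, ?_, ?_, ?_⟩
  · rintro ⟨ip, rfl⟩
    exact LinInfo.eDetNon_le_of_inner S F hF hn hα
  · rintro hsymm ⟨ip, rfl⟩
    exact LinInfo.eDetNon_le_of_symmetric_of_inner S F hF hsymm hn hα
  · rintro ⟨ip, rfl⟩ rfl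
    exact LinInfo.eDetNon_closedBall_le S hn hα
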